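/- For metric spaces $X$ and $Y$, a subset of $X$ is a copy of $Y$ if it is the image of $Y$ under a distance-preserving map, and $\chi(X,Y)$ denotes the smallest $k$ such that the points of $X$ can be coloured with $k$ colours with no monochromatic copy of $Y$ (with $\chi(X,Y)=\infty$ if there is no such $k$). Let $\mathbb R^n_\infty$ be $\mathbb R^n$ with the maximum metric, and for $q>0$ let $\mathcal G(q)=\{0,\,1,\,1+q,\,1+q+q^2,\,\ldots\}\subset\mathbb R$ with the standard metric of $\mathbb R$. A copy $\mathcal C\subset\mathbb R^n_\infty$ of $\mathcal G(q)$ is called proper if for some $i\in\{1,\ldots,n\}$ the set of $i$-th coordinates of the points of $\mathcal C$ is a translate of $-\mathcal G(q)$. A metric space $\mathcal M$ is called $\ell_\infty$-Ramsey if $\chi(\mathbb R^n_\infty,\mathcal M)\to\infty$ as $n\to\infty$. (1) For every $0<\varepsilon<\frac12$ there exists $q_0>0$ such that for all $0<q\le q_0$ and all $k\in\mathbb N$, every $k$-colouring of the cube $[-\varepsilon,1+\varepsilon]^{3^k}$ with the maximum metric contains a monochromatic proper copy of $\mathcal G(q)$. (2) There exists $q_0>0$ such that for all $0<q\le q_0$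 and all integers $n\ge1$, $$\chi(\mathbb R^n_\infty,\mathcal G(q))>\log_3 n.$$ (3) Consequently, an infinite $\ell_\infty$-Ramsey metric space exists. -/

import Mathlib

open Set Filter Topology
open scoped ENNReal

/-- `C` is a copy of the metric space `Y` inside the metric space `X`: there is a
distance-preserving bijection from `Y` onto `C`. -/
def IsCopy {X : Type*} [MetricSpace X] (Y : Type*) [MetricSpace Y] (C : Set X) : Prop :=
  ∃ f : Y → X, Isometry f ∧ Set.range f = C

/-- All points of `C` receive the same colour under `c`. -/
def IsMonochromatic {X κ : Type*} (c : X → κ) (C : Set X) : Prop :=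
  ∃ a : κ, ∀ x ∈ C, c x = a

/-- `X` can be coloured with `k` colours without a monochromatic copy of `Y`. -/
def AvoidsWithColours (X : Type*) [MetricSpace X] (Y : Type*) [MetricSpace Y] (k : ℕ) : Prop :=
  ∃ c : X → Fin k, ∀ C : Set X, IsCopy Y C → ¬ IsMonochromatic c C

/-- The chromatic number of `X` with forbidden subspace `Y`: the smallest `k` such that `X` can be
coloured with `k` colours without a monochromatic copy of `Y` (and `⊤` if there is no such `k`). -/
noncomputable def metricChromaticNumber (X : Type*) [MetricSpace X] (Y : Type*) [MetricSpace Y] :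
    ℕ∞ :=
  ⨅ (k : ℕ) (_ : AvoidsWithColours X Y k), (k : ℕ∞)

/-- `Y` is `ℓ_∞`-Ramsey: the chromatic number of `ℝⁿ` with the maximum metric (the metric that
`Fin n → ℝ` carries) and forbidden subspace `Y` tends to infinity with `n`. -/
def IsLInftyRamsey (Y : Type*) [MetricSpace Y] : Prop :=
  Tendsto (fun n : ℕ => metricChromaticNumber (Fin n → ℝ) Y) atTop (𝓝 ⊤)

/-- The geometric progression `{0, 1, 1 + q, 1 + q + q², …}`, with the metric of the real line. -/
def geomProg (q : ℝ) : Set ℝ :=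
  Set.range fun m : ℕ => ∑ i ∈ Finset.range m, q ^ i

/-- `C ⊆ ℝⁿ` is a proper isometric copy of `geomProg q`: it is a copy and, for some `i`, the
`i`-th coordinates of its points form a translation of `-geomProg q`. -/
def IsProperCopy {n : ℕ} (q : ℝ) (C : Set (Fin n → ℝ)) : Prop :=
  IsCopy (geomProg q) C ∧
    ∃ (i : Fin n) (a : ℝ), (fun x : Fin n → ℝ => x i) '' C = (fun g : ℝ => a - g) '' geomProg q

/-- The cube `[-ε, 1 + ε]ⁿ`. -/
def epsCube (n : ℕ) (ε : ℝ) : Set (Fin n → ℝ) :=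
  {x | ∀ i, x i ∈ Set.Icc (-ε) (1 + ε)}

/-! The proof is by induction on the number of colours, each step tripling the dimension
(`HasMonoChains.succ`). Coordinates split into three blocks, and cells are copies of the
lower-dimensional cube scaled by `q ^ j`. If all cells at all scales contain all colours, let the
centre in one block fall by `1, q, q², …` in one coordinate and pick a point of a fixed colour in
each cell: cells shrink so fast that the free coordinates never exceed the prescribed distances.
Otherwise take the coarsest scale `q ^ m` with a cell missing a colour. By induction this cell holds
a monochromatic chain with first step `q ^ m`. The steps `1, …, q ^ (m - 1)` before it come from
coarser cells, which are full, with the blocks `some f` and `some !f` exchanging roles. Both of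
these blocks must lie near `0` to leave room for a descent of length `1 / (1 - q)`, whereas a cell
of scale `1` is centred at `1/2`; hence the third block. -/

/-- The points of `ι → ℝ` all of whose coordinates lie in `[-ε, 1 + ε]`. -/
def coordCube (ι : Type) (ε : ℝ) : Set (ι → ℝ) :=
  {x | ∀ i, x i ∈ Set.Icc (-ε) (1 + ε)}

/-- A sequence of points whose consecutive distances are `1, q, q², …`, each of these distances
being realized by a decrease of the `i`-th coordinate. -/
structure IsGeomChain {ι : Type} (q : ℝ) (i : ι) (x : ℕ → ι → ℝ) : Prop where
  special : ∀ l, x (l + 1) i = x l i - q ^ l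
  step : ∀ l j, |x (l + 1) j - x l j| ≤ q ^ l

/-- Every colouring of the cube over `ι` with at most `k` colours has a monochromatic chain. -/
def HasMonoChains (ι : Type) (ε q : ℝ) (k : ℕ) : Prop :=
  ∀ (c : (ι → ℝ) → ℕ) (S : Finset ℕ), S.card ≤ k → (∀ x ∈ coordCube ι ε, c x ∈ S) →
    ∃ (x : ℕ → ι → ℝ) (i : ι) (a : ℕ),
      IsGeomChain q i x ∧ (∀ l, x l ∈ coordCube ι ε) ∧ ∀ l, c (x l) = a

/-- The point of `(ι → ℝ)³` with block `u` at `some f`, block `v` at `some !f`, and block `w`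
at `none`. -/
def blockPoint {ι : Type} (f : Bool) (u v w : ι → ℝ) : Option Bool × ι → ℝ
  | (none, j) => w j
  | (some b, j) => if b = f then u j else v j

lemma forall_blockPoint {ι : Type} {f : Bool} {P : Option Bool × ι → Prop} :
    (∀ p, P p) ↔ (∀ j, P (some f, j)) ∧ (∀ j, P (some (!f), j)) ∧ ∀ j, P (none, j) := by
  refine ⟨fun h => ⟨fun j => h _, fun j => h _, fun j => h _⟩, ?_⟩
  rintro ⟨h1, h2, h3⟩ ⟨_ | b, j⟩
  · exact h3 j
  · rcases Bool.eq_or_eq_not b f with rfl | rfl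
    · exact h1 j
    · exact h2 j

section blockPoint
variable {ι : Type} (f : Bool) (u v w : ι → ℝ) (j : ι)

@[simp] lemma blockPoint_none : blockPoint f u v w (none, j) = w j := rfl

@[simp] lemma blockPoint_self : blockPoint f u v w (some f, j) = u j := by simp [blockPoint]

@[simp] lemma blockPoint_not : blockPoint f u v w (some (!f), j) = v j := by simp [blockPoint]

lemma blockPoint_not_eq : blockPoint (!f) u v w = blockPoint f v u w := by
  funext p
  revert p
  rw [forall_blockPoint (f := f)]
  refine ⟨fun j => ?_, fun j => ?_, fun j => rfl⟩
  · simp [blockPoint]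
  · simp [blockPoint]

end blockPoint

lemma blockPoint_mem {ι : Type} {ε : ℝ} {f : Bool} {u v w : ι → ℝ} (hu : u ∈ coordCube ι ε)
    (hv : v ∈ coordCube ι ε) (hw : w ∈ coordCube ι ε) :
    blockPoint f u v w ∈ coordCube (Option Bool × ι) ε := by
  unfold coordCube
  rw [Set.mem_ofPred_eq, forall_blockPoint (f := f)]
  simp only [blockPoint_self, blockPoint_not, blockPoint_none]
  exact ⟨hu, hv, hw⟩

lemma blockPoint_step {ι : Type} {f : Bool} {u v w u' v' w' : ι → ℝ} {r : ℝ}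
    (hu : ∀ j, |u' j - u j| ≤ r) (hv : ∀ j, |v' j - v j| ≤ r) (hw : ∀ j, |w' j - w j| ≤ r) :
    ∀ p, |blockPoint f u' v' w' p - blockPoint f u v w p| ≤ r := by
  rw [forall_blockPoint (f := f)]
  simp only [blockPoint_self, blockPoint_not, blockPoint_none]
  exact ⟨hu, hv, hw⟩

/-! ### Numerical estimates -/

/-- The common ratio `q` is small in terms of `ε`. -/
structure SmallRatio (ε q : ℝ) : Prop where
  eps_pos : 0 < ε
  eps_lt : ε < 1 / 2
  pos : 0 < q
  le_eps : 6 * q ≤ ε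
  le_half : q ≤ 1 / 2 - ε

namespace SmallRatio
variable {ε q : ℝ}

lemma le_eighth (h : SmallRatio ε q) : q ≤ 1 / 8 := by
  linarith [h.le_eps, h.eps_lt]

lemma lt_one (h : SmallRatio ε q) : q < 1 := by linarith [h.le_eighth]

lemma pow_le (h : SmallRatio ε q) {a b : ℕ} (hab : a ≤ b) : q ^ b ≤ q ^ a :=
  pow_le_pow_of_le_one h.pos.le h.lt_one.le hab

lemma pow_succ_le (h : SmallRatio ε q) (j : ℕ) : q ^ (j + 1) ≤ q :=
  (h.pow_le (by omega : 1 ≤ j + 1)).trans_eq (pow_one q)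

lemma mem_cube {ι : Type} (h : SmallRatio ε q) {j : ℕ} {u : ι → ℝ}
    (hu : ∀ i, |u i| ≤ 4 * q ^ (j + 1)) : u ∈ coordCube ι ε := by
  intro i
  have h1 := abs_le.1 (hu i)
  have := h.pow_succ_le j
  have := h.le_eps
  constructor <;> linarith [h.eps_pos]

lemma half_mem_cube {ι : Type} (h : SmallRatio ε q) : (fun _ => 1 / 2) ∈ coordCube ι ε := by
  intro i
  constructor <;> linarith [h.eps_pos]

lemma two_steps (h : SmallRatio ε q) (j : ℕ) :
    (1 / 2 + ε) * q ^ j + (1 / 2 + ε) * q ^ (j + 1) ≤ q ^ j := by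
  have h1 : (1 / 2 + ε) * (1 + q) ≤ 1 := by
    -- With `q ≤ 1/2 - ε` the product is at most `1 - (1/2 - ε)²`.
    nlinarith [h.le_half, h.eps_pos, h.eps_lt, sq_nonneg (ε - 1 / 2)]
  have h2 := pow_pos h.pos j
  rw [pow_succ]
  nlinarith

lemma one_step (h : SmallRatio ε q) (j : ℕ) : (1 / 2 + ε) * q ^ j ≤ q ^ j := by
  have := pow_pos h.pos j
  nlinarith [h.eps_lt]

/-- A recursion for the sum `q ^ j + q ^ (j + 1) + … = q ^ j / (1 - q)`. -/
lemma tail_succ (h : SmallRatio ε q) (j : ℕ) :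
    q ^ (j + 1) / (1 - q) = q ^ j / (1 - q) - q ^ j := by
  have : 1 - q ≠ 0 := by linarith [h.lt_one]
  field_simp
  ring

lemma tail_le (h : SmallRatio ε q) (j : ℕ) : q ^ j / (1 - q) ≤ 8 / 7 * q ^ j := by
  have h2 := pow_pos h.pos j
  rw [div_le_iff₀ (by linarith [h.lt_one])]
  nlinarith [h.le_eighth]

lemma tail_pos (h : SmallRatio ε q) (j : ℕ) : 0 < q ^ j / (1 - q) :=
  div_pos (pow_pos h.pos j) (by linarith [h.lt_one])

end SmallRatio

/-! ### Cells and their centres -/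

/-- The admissible centres of cells of scale `q ^ j`. -/
def IsCentre {ι : Type} (ε q : ℝ) : ℕ → (ι → ℝ) → Prop
  | 0, u => u ∈ coordCube ι ε
  | j + 1, u => ∀ i, |u i| ≤ 3 * q ^ (j + 1)

/-- The coordinates in the block `some !f` of the points of a cell of scale `q ^ j`. -/
noncomputable def cellSide {ι : Type} (q : ℝ) : ℕ → (ι → ℝ) → (ι → ℝ) → ι → ℝ
  | 0, b, _ => b
  | j + 1, b, t => fun i => b i + q ^ (j + 1) * (t i - 1 / 2)

/-- The coordinates in the block `none` of the points of a cell of scale `q ^ j`. -/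
noncomputable def cellTop {ι : Type} : ℕ → (ι → ℝ) → ι → ℝ
  | 0, t => t
  | _ + 1, _ => fun _ => 1 / 2

/-- The point with parameter `t` of a cell of scale `q ^ j`: a cube of dimension `|ι|` whose free
coordinates form the block `some !f` or, for `j = 0`, the block `none`. -/
noncomputable def cellPoint {ι : Type} (q : ℝ) (j : ℕ) (f : Bool) (u b t : ι → ℝ) :
    Option Bool × ι → ℝ :=
  blockPoint f u (cellSide q j b t) (cellTop j t)

/-- All cells of scale `q ^ j` contain all colours. -/
def AllCellsFull {ι : Type} (ε q : ℝ) (c : (Option Bool × ι → ℝ) → ℕ) (S : Finset ℕ) (j : ℕ) :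
    Prop :=
  ∀ a ∈ S, ∀ (f : Bool) (u b : ι → ℝ), IsCentre ε q j u → IsCentre ε q j b →
    ∃ t ∈ coordCube ι ε, c (cellPoint q j f u b t) = a

section cells
variable {ι : Type} {ε q : ℝ}

lemma abs_cellSide_sub_le (h : SmallRatio ε q) (j : ℕ) (b : ι → ℝ) {t : ι → ℝ}
    (ht : t ∈ coordCube ι ε) (i : ι) : |cellSide q j b t i - b i| ≤ (1 / 2 + ε) * q ^ j := by
  have h2 := pow_pos h.pos j
  cases j with
  | zero => simp [cellSide]; linarith [h.eps_pos]
  | succ j =>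
    simp only [cellSide, add_sub_cancel_left]
    rw [abs_mul, abs_of_pos h2, mul_comm]
    refine mul_le_mul_of_nonneg_right ?_ h2.le
    have := ht i
    rw [abs_le]
    constructor <;> linarith [this.1, this.2]

lemma abs_cellTop_sub_le (h : SmallRatio ε q) (j : ℕ) {t : ι → ℝ}
    (ht : t ∈ coordCube ι ε) (i : ι) : |cellTop j t i - 1 / 2| ≤ (1 / 2 + ε) * q ^ j := by
  have h2 := pow_pos h.pos j
  cases j with
  | zero =>
    have := ht i
    simp only [cellTop, pow_zero, mul_one]
    rw [abs_le]
    constructor <;> linarith [this.1, this.2]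
  | succ j =>
    simp only [cellTop, sub_self, abs_zero]
    have := h.eps_pos
    positivity

lemma IsCentre.mem_cube (h : SmallRatio ε q) {j : ℕ} {u : ι → ℝ} (hu : IsCentre ε q j u) :
    u ∈ coordCube ι ε := by
  cases j with
  | zero => exact hu
  | succ j => exact h.mem_cube fun i => (hu i).trans (by linarith [pow_pos h.pos (j + 1)])

lemma isCentre_of_le (h : SmallRatio ε q) (j : ℕ) {u : ι → ℝ}
    (hu : ∀ i, |u i| ≤ 3 * q ^ (j + 1)) {l : ℕ} (hl : l ≤ j + 1) : IsCentre ε q l u := by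
  cases l with
  | zero => exact IsCentre.mem_cube (j := j + 1) h hu
  | succ l => exact fun i => (hu i).trans (by linarith [h.pow_le hl])

lemma abs_cellSide_le (h : SmallRatio ε q) {j : ℕ} {b t : ι → ℝ} (hb : IsCentre ε q (j + 1) b)
    (ht : t ∈ coordCube ι ε) (i : ι) : |cellSide q (j + 1) b t i| ≤ 4 * q ^ (j + 1) := by
  have h1 := abs_cellSide_sub_le h (j + 1) b ht i
  have h2 := hb i
  have h3 := h.one_step (j + 1)
  rw [abs_le] at *
  constructor <;> linarith

lemma cellPoint_mem (h : SmallRatio ε q) {j : ℕ} (f : Bool) {u b t : ι → ℝ}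
    (hu : u ∈ coordCube ι ε) (hb : IsCentre ε q j b) (ht : t ∈ coordCube ι ε) :
    cellPoint q j f u b t ∈ coordCube (Option Bool × ι) ε := by
  cases j with
  | zero => exact blockPoint_mem hu hb ht
  | succ j => exact blockPoint_mem hu (h.mem_cube (abs_cellSide_le h hb ht)) h.half_mem_cube

/-- Two points of consecutive cells with common centre in the block `some !f` are close to each
other if their blocks `some f` are. -/
lemma cellPoint_step (h : SmallRatio ε q) {j : ℕ} (f : Bool) {u u' b t t' : ι → ℝ}
    (hu : ∀ i, |u' i - u i| ≤ q ^ j) (ht : t ∈ coordCube ι ε) (ht' : t' ∈ coordCube ι ε)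
    (p : Option Bool × ι) :
    |cellPoint q (j + 1) f u' b t' p - cellPoint q j f u b t p| ≤ q ^ j := by
  refine blockPoint_step hu (fun i => ?_) (fun i => ?_) p
  · have h1 := abs_cellSide_sub_le h j b ht i
    have h2 := abs_cellSide_sub_le h (j + 1) b ht' i
    have h3 := h.two_steps j
    rw [abs_le] at *
    constructor <;> linarith
  · have h1 := abs_cellTop_sub_le h j ht i
    rw [abs_sub_comm]
    exact h1.trans (h.one_step j)

end cells

/-- The point `y` with its `i`-th coordinate shifted by `q ^ j + q ^ (j + 1) + … - s`. -/
noncomputable def tailShift {ι : Type} [DecidableEq ι] (q : ℝ) (y : ι → ℝ) (i : ι) (s : ℝ) (j : ℕ) :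
    ι → ℝ :=
  Function.update y i (y i + (q ^ j / (1 - q) - s))

section shift
variable {ι : Type} [DecidableEq ι] {ε q : ℝ}

lemma tailShift_self (y : ι → ℝ) (i : ι) (s : ℝ) (j : ℕ) :
    tailShift q y i s j i = y i + (q ^ j / (1 - q) - s) := by simp [tailShift]

lemma tailShift_succ (h : SmallRatio ε q) (y : ι → ℝ) (i : ι) (s : ℝ) (j : ℕ) :
    tailShift q y i s (j + 1) i = tailShift q y i s j i - q ^ j := by
  rw [tailShift_self, tailShift_self, h.tail_succ]
  ring

lemma tailShift_step (h : SmallRatio ε q) (y : ι → ℝ) (i : ι) (s : ℝ) (j : ℕ) (l : ι) :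
    |tailShift q y i s (j + 1) l - tailShift q y i s j l| ≤ q ^ j := by
  have := pow_pos h.pos j
  by_cases hl : l = i
  · subst hl
    rw [tailShift_succ h, sub_sub_cancel_left, abs_neg, abs_of_pos this]
  · simp [tailShift, hl, this.le]

/-- At scale `1` the coordinate reaches at most `4 * q + 1 / (1 - q) ≤ 1 + 6 * q`, whence the
condition `6 * q ≤ ε`. At finer scales `4 * q ^ (j + 1)` is at most half of `q ^ j`, so the bound `3
* q ^ j` has room to spare. -/
lemma tailShift_isCentre (h : SmallRatio ε q) {y : ι → ℝ} (i : ι) {s : ℝ} {j : ℕ}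
    (hy : ∀ l, |y l| ≤ 4 * q ^ (j + 1)) (hs : 0 ≤ s) (hs' : s ≤ q ^ j / (1 - q)) :
    IsCentre ε q j (tailShift q y i s j) := by
  have h1 := h.tail_le j
  have h2 := h.le_eighth
  have h3 : q ^ (j + 1) ≤ 1 / 8 * q ^ j := by
    rw [pow_succ]
    nlinarith [pow_pos h.pos j]
  have h4 : ∀ l, |y l| ≤ 3 * q ^ j := fun l => (hy l).trans (by linarith [pow_pos h.pos j])
  have h5 := abs_le.1 (hy i)
  have h6 := h.mem_cube hy
  cases j with
  | zero =>
    intro l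
    by_cases hl : l = i
    · subst hl
      rw [tailShift_self]
      have h7 := h.tail_succ 0
      have h8 := h.tail_le 1
      have := h6 l
      have h9 := h.le_eps
      have h10 := h.pos
      simp only [zero_add, pow_zero, pow_one] at *
      constructor <;> linarith [this.1, h.eps_pos]
    · simpa [tailShift, hl] using h6 l
  | succ j =>
    intro l
    by_cases hl : l = i
    · subst hl
      rw [tailShift_self, abs_le]
      constructor <;> linarith
    · simpa [tailShift, hl] using h4 l

end shift

/-! ### Chains and the induction on colours -/

section chains
variable {ι : Type} {ε q : ℝ}

lemma IsGeomChain.cellPoint (h : SmallRatio ε q) (f : Bool) {U T : ℕ → ι → ℝ} {i : ι} (b : ι → ℝ)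
    (hU : IsGeomChain q i U) (hT : ∀ j, T j ∈ coordCube ι ε) :
    IsGeomChain q (some f, i) fun j => cellPoint q j f (U j) b (T j) where
  special j := by simpa [_root_.cellPoint] using hU.special j
  step j := cellPoint_step h f (hU.step j) (hT j) (hT (j + 1))

lemma isGeomChain_tailShift [DecidableEq ι] (h : SmallRatio ε q) (y : ι → ℝ) (i : ι) (s : ℝ) :
    IsGeomChain q i (tailShift q y i s) where
  special := tailShift_succ h y i s
  step := tailShift_step h y i s

/-- If all cells contain all colours, then a monochromatic chain can be chosen point by point. -/
lemma exists_chain_of_full [Nonempty ι] (h : SmallRatio ε q) {c : (Option Bool × ι → ℝ) → ℕ}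
    {S : Finset ℕ} {a : ℕ} (ha : a ∈ S) (hfull : ∀ j, AllCellsFull ε q c S j) :
    ∃ (x : ℕ → Option Bool × ι → ℝ) (p : Option Bool × ι) (a : ℕ),
      IsGeomChain q p x ∧ (∀ l, x l ∈ coordCube _ ε) ∧ ∀ l, c (x l) = a := by
  classical
  obtain ⟨i⟩ := ‹Nonempty ι›
  have hcen : ∀ j, IsCentre ε q j (tailShift q 0 i 0 j) := fun j =>
    tailShift_isCentre h i (fun l => by simpa using pow_nonneg h.pos.le _) le_rfl (h.tail_pos j).le
  have h0 : ∀ j, IsCentre ε q j (0 : ι → ℝ) := fun j =>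
    isCentre_of_le h j (fun l => by simpa using pow_nonneg h.pos.le _) (Nat.le_succ j)
  choose T hT hTc using fun j => hfull j a ha true _ _ (hcen j) (h0 j)
  exact ⟨_, (some true, i), a, (isGeomChain_tailShift h 0 i 0).cellPoint h true 0 hT,
    fun j => cellPoint_mem h true ((hcen j).mem_cube h) (h0 j) (hT j), hTc⟩

lemma cellSide_half (j : ℕ) (b : ι → ℝ) : cellSide q j b (fun _ => 1 / 2) = b := by
  cases j <;> simp [cellSide]

/-- This is the exchange of roles: a point of a small cell is also the midpoint of a cell of any
scale whose free block is the other one, so `IsGeomChain.cellPoint` covers the whole prolonged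
chain. -/
lemma cellPoint_eq_cellPoint_not (m l : ℕ) (f : Bool) (u b t : ι → ℝ) :
    cellPoint q (m + 1) f u b t =
      cellPoint q l (!f) (cellSide q (m + 1) b t) u (fun _ => 1 / 2) := by
  unfold cellPoint
  rw [blockPoint_not_eq, cellSide_half]
  cases l <;> rfl

/-- A chain in a small cell, prolonged at its beginning by shifts of its first point. -/
lemma IsGeomChain.prolong [DecidableEq ι] (h : SmallRatio ε q) {m : ℕ} (b : ι → ℝ)
    {t : ℕ → ι → ℝ} {i : ι} (ht : IsGeomChain q i t) :
    IsGeomChain q i fun j =>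
      if j < m + 1 then tailShift q (cellSide q (m + 1) b (t 0)) i (q ^ (m + 1) / (1 - q)) j
      else cellSide q (m + 1) b (t (j - (m + 1))) := by
  set y := cellSide q (m + 1) b (t 0)
  set s := q ^ (m + 1) / (1 - q)
  have hsh := isGeomChain_tailShift h y i s
  -- The shift vanishes exactly where the given chain begins, so the two pieces join.
  have hm : tailShift q y i s (m + 1) = y := by simp [tailShift, s]
  have key : ∀ j, (j < m + 1 ∧ (if j + 1 < m + 1 then tailShift q y i s (j + 1)
      else cellSide q (m + 1) b (t (j + 1 - (m + 1)))) = tailShift q y i s (j + 1)) ∨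
      ∃ l, j = m + 1 + l := by
    intro j
    rcases lt_or_ge j (m + 1) with hj | hj
    · refine Or.inl ⟨hj, ?_⟩
      split_ifs with h1
      · rfl
      · obtain rfl : j = m := by omega
        rw [hm, Nat.sub_self]
    · exact Or.inr ⟨j - (m + 1), by omega⟩
  have hsub : ∀ l k, cellSide q (m + 1) b (t (l + 1)) k - cellSide q (m + 1) b (t l) k =
      q ^ (m + 1) * (t (l + 1) k - t l k) := by
    intro l k
    simp only [cellSide]
    ring
  constructor
  · intro j
    rcases key j with ⟨hj, he⟩ | ⟨l, rfl⟩
    · rw [he, if_pos hj]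
      exact hsh.special j
    · have e1 : m + 1 + l + 1 - (m + 1) = l + 1 := by omega
      rw [if_neg (by omega), if_neg (by omega), e1, Nat.add_sub_cancel_left]
      have := hsub l i
      rw [ht.special l] at this
      rw [pow_add]
      linarith
  · intro j k
    rcases key j with ⟨hj, he⟩ | ⟨l, rfl⟩
    · rw [he, if_pos hj]
      exact hsh.step j k
    · have e1 : m + 1 + l + 1 - (m + 1) = l + 1 := by omega
      rw [if_neg (by omega), if_neg (by omega), e1, Nat.add_sub_cancel_left, hsub, abs_mul,
        abs_of_pos (pow_pos h.pos _), pow_add q (m + 1) l]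
      exact mul_le_mul_of_nonneg_left (ht.step l k) (pow_nonneg h.pos.le _)

lemma HasMonoChains.succ [Nonempty ι] (h : SmallRatio ε q) {k : ℕ} (ih : HasMonoChains ι ε q k) :
    HasMonoChains (Option Bool × ι) ε q (k + 1) := by
  classical
  intro c S hS hc
  by_cases hfull : ∀ j, AllCellsFull ε q c S j
  · exact exists_chain_of_full h (hc _ h.half_mem_cube) hfull
  push Not at hfull
  obtain ⟨m, hm, hmin⟩ : ∃ m, ¬ AllCellsFull ε q c S m ∧ ∀ j < m, AllCellsFull ε q c S j :=
    ⟨Nat.find hfull, Nat.find_spec hfull, fun j hj => not_not.1 (Nat.find_min hfull hj)⟩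
  unfold AllCellsFull at hm
  push Not at hm
  obtain ⟨a, ha, f, u, b, hu, hb, hne⟩ := hm
  have hmem : ∀ t ∈ coordCube ι ε, cellPoint q m f u b t ∈ coordCube (Option Bool × ι) ε :=
    fun t ht => cellPoint_mem h f (hu.mem_cube h) hb ht
  obtain ⟨t, i, a', ht, htc, hta⟩ := ih (fun t => c (cellPoint q m f u b t)) (S.erase a)
    (by rw [Finset.card_erase_of_mem ha]; omega)
    (fun t ht => Finset.mem_erase.2 ⟨hne t ht, hc _ (hmem t ht)⟩)
  have ha' : a' ∈ S := hta 0 ▸ hc _ (hmem _ (htc 0))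
  cases m with
  -- A chain in a cell of scale `1` needs no prolongation.
  | zero =>
    refine ⟨fun l => cellPoint q 0 f u b (t l), (none, i), a', ⟨fun l => ht.special l, fun l => ?_⟩,
      fun l => hmem _ (htc l), hta⟩
    have := pow_nonneg h.pos.le l
    exact blockPoint_step (by simpa using this) (by simpa [cellSide] using this) (ht.step l)
  | succ m =>
    have hy : ∀ l i, |cellSide q (m + 1) b (t l) i| ≤ 4 * q ^ (m + 1) := fun l i =>
      abs_cellSide_le h hb (htc l) i
    have hcen : ∀ j < m + 1, IsCentre ε q j
        (tailShift q (cellSide q (m + 1) b (t 0)) i (q ^ (m + 1) / (1 - q)) j) := fun j hj =>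
      tailShift_isCentre h i
        (fun l => (hy 0 l).trans (by linarith [h.pow_le (show j + 1 ≤ m + 1 by omega)]))
        (h.tail_pos _).le
        (div_le_div_of_nonneg_right (h.pow_le hj.le) (by linarith [h.lt_one]))
    have hcu : ∀ j < m + 1, IsCentre ε q j u := fun j hj => isCentre_of_le h m hu hj.le
    choose T hT hTc using fun j hj => hmin j hj a' ha' (!f) _ _ (hcen j hj) (hcu j hj)
    -- The default `1/2` selects midpoints, that is, the points of the chain in the deficient cell.
    have hT' : ∀ j, (if hj : j < m + 1 then T j hj else fun _ => 1 / 2) ∈ coordCube ι ε := by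
      intro j
      split_ifs with hj
      · exact hT j hj
      · exact h.half_mem_cube
    refine ⟨_, (some (!f), i), a', (ht.prolong h (m := m) b).cellPoint h (!f) u hT', ?_, ?_⟩
    · intro j
      split_ifs with hj
      · exact cellPoint_mem h _ ((hcen j hj).mem_cube h) (hcu j hj) (hT j hj)
      · rw [← cellPoint_eq_cellPoint_not]
        exact hmem _ (htc _)
    · intro j
      split_ifs with hj
      · exact hTc j hj
      · rw [← cellPoint_eq_cellPoint_not]
        exact hta _

lemma HasMonoChains.congr {ι' : Type} {k : ℕ} (e : ι ≃ ι') (ih : HasMonoChains ι ε q k) :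
    HasMonoChains ι' ε q k := by
  intro c S hS hc
  obtain ⟨x, i, a, hx, hxc, hxa⟩ := ih (fun x => c (x ∘ e.symm)) S hS
    fun x hx => hc _ fun i => hx (e.symm i)
  exact ⟨fun l => x l ∘ e.symm, e i, a,
    ⟨fun l => by simpa using hx.special l, fun l j => hx.step l (e.symm j)⟩,
    fun l j => hxc l (e.symm j), hxa⟩

theorem hasMonoChains (h : SmallRatio ε q) (k : ℕ) : HasMonoChains (Fin (3 ^ k)) ε q k := by
  induction k with
  | zero =>
    intro c S hS hc
    have := hc _ h.half_mem_cube
    rw [Finset.card_eq_zero.1 (Nat.le_zero.1 hS)] at this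
    simp at this
  | succ k ih =>
    have : Nonempty (Fin (3 ^ k)) := ⟨⟨0, by positivity⟩⟩
    exact (ih.succ h).congr (Fintype.equivFinOfCardEq (by simp [pow_succ, mul_comm]))

end chains

/-! ### From chains to copies and chromatic numbers -/

section copies
variable {ε q : ℝ}

lemma geomProg_strictMono (hq : 0 < q) : StrictMono fun m : ℕ => ∑ i ∈ Finset.range m, q ^ i :=
  strictMono_nat_of_lt_succ fun m => by
    rw [Finset.sum_range_succ]
    linarith [pow_pos hq m]

namespace IsGeomChain
variable {ι : Type} {i : ι} {x : ℕ → ι → ℝ}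

lemma apply_eq (hx : IsGeomChain q i x) (m : ℕ) :
    x m i = x 0 i - ∑ l ∈ Finset.range m, q ^ l := by
  induction m with
  | zero => simp
  | succ m ih => rw [hx.special, ih, Finset.sum_range_succ]; ring

lemma abs_sub_le (hx : IsGeomChain q i x) (j : ι) {m n : ℕ} (hmn : m ≤ n) :
    |x n j - x m j| ≤ ∑ l ∈ Finset.range n, q ^ l - ∑ l ∈ Finset.range m, q ^ l := by
  induction n, hmn using Nat.le_induction with
  | base => simp
  | succ n _ ih =>
    rw [Finset.sum_range_succ]
    have := _root_.abs_sub_le (x (n + 1) j) (x n j) (x m j)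
    linarith [hx.step n j]

/-- The triangle inequality bounds every coordinate, and the monotone coordinate `i` attains the
bound. -/
lemma dist_eq [Fintype ι] (hx : IsGeomChain q i x) (m n : ℕ) :
    dist (x m) (x n) =
      dist (∑ l ∈ Finset.range m, q ^ l) (∑ l ∈ Finset.range n, q ^ l) := by
  wlog hmn : m ≤ n generalizing m n
  · rw [dist_comm, this n m (by omega), dist_comm]
  apply le_antisymm
  · refine (dist_pi_le_iff dist_nonneg).2 fun j => ?_
    rw [dist_comm, dist_comm (Finset.sum _ _), Real.dist_eq, Real.dist_eq]
    exact (hx.abs_sub_le j hmn).trans (le_abs_self _)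
  · refine le_trans (le_of_eq ?_) (dist_le_pi_dist (x m) (x n) i)
    rw [Real.dist_eq, Real.dist_eq, hx.apply_eq m, hx.apply_eq n, ← abs_neg]
    congr 1
    ring

lemma isCopy [Fintype ι] (hq : 0 < q) (hx : IsGeomChain q i x) :
    IsCopy (geomProg q) (Set.range x) := by
  let e := Equiv.ofInjective _ (geomProg_strictMono hq).injective
  refine ⟨fun g : geomProg q => x (e.symm g), Isometry.of_dist_eq ?_, ?_⟩
  · intro a b
    obtain ⟨m, rfl⟩ := e.surjective a
    obtain ⟨n, rfl⟩ := e.surjective b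
    rw [e.symm_apply_apply, e.symm_apply_apply, hx.dist_eq]
    rfl
  · exact e.symm.surjective.range_comp x

lemma isProperCopy {n : ℕ} {i : Fin n} {x : ℕ → Fin n → ℝ} (hq : 0 < q)
    (hx : IsGeomChain q i x) : IsProperCopy q (Set.range x) := by
  refine ⟨hx.isCopy hq, i, x 0 i, ?_⟩
  rw [geomProg, ← Set.range_comp, ← Set.range_comp]
  congr 1
  funext m
  exact hx.apply_eq m

end IsGeomChain

theorem exists_monochromatic_properCopy (h : SmallRatio ε q) (k : ℕ)
    (c : epsCube (3 ^ k) ε → Fin k) :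
    ∃ C : Set (epsCube (3 ^ k) ε), IsMonochromatic c C ∧ IsProperCopy q (Subtype.val '' C) := by
  classical
  obtain ⟨x, i, a, hx, hxc, hxa⟩ := hasMonoChains h k
    (fun x => if hx : x ∈ epsCube (3 ^ k) ε then (c ⟨x, hx⟩ : ℕ) else 0) (Finset.range k)
    (by simp) (fun x hx => by
      have hx' : x ∈ epsCube (3 ^ k) ε := hx
      simp [hx'])
  have hxa' : ∀ l, (c ⟨x l, hxc l⟩ : ℕ) = a := fun l => by
    have hx' : x l ∈ epsCube (3 ^ k) ε := hxc l
    simpa [hx'] using hxa l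
  refine ⟨Set.range fun l => ⟨x l, hxc l⟩, ⟨c ⟨x 0, hxc 0⟩, ?_⟩, ?_⟩
  · rintro _ ⟨l, rfl⟩
    exact Fin.ext ((hxa' l).trans (hxa' 0).symm)
  · rw [← Set.range_comp]
    exact hx.isProperCopy h.pos

lemma IsCopy.image {X Z Y : Type*} [MetricSpace X] [MetricSpace Z] [MetricSpace Y] {C : Set X}
    (hC : IsCopy Y C) {g : X → Z} (hg : Isometry g) : IsCopy Y (g '' C) := by
  obtain ⟨f, hf, rfl⟩ := hC
  exact ⟨g ∘ f, hg.comp hf, Set.range_comp g f⟩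

/-- Spaces with the maximum metric embed isometrically into those of larger dimension. -/
lemma exists_isometry_fin {m n : ℕ} (hmn : m ≤ n) :
    ∃ g : (Fin m → ℝ) → (Fin n → ℝ), Isometry g := by
  refine ⟨fun x j => if hj : (j : ℕ) < m then x ⟨j, hj⟩ else 0, Isometry.of_dist_eq fun x y => ?_⟩
  apply le_antisymm
  · refine (dist_pi_le_iff dist_nonneg).2 fun j => ?_
    split_ifs with hj
    · exact dist_le_pi_dist x y _
    · simp
  · refine (dist_pi_le_iff dist_nonneg).2 fun j => ?_
    refine le_trans (le_of_eq ?_) (dist_le_pi_dist _ _ (Fin.castLE hmn j))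
    simp

lemma not_avoidsWithColours (h : SmallRatio ε q) {k n : ℕ} (hkn : 3 ^ k ≤ n) :
    ¬ AvoidsWithColours (Fin n → ℝ) (geomProg q) k := by
  rintro ⟨c, hc⟩
  obtain ⟨g, hg⟩ := exists_isometry_fin hkn
  obtain ⟨C, ⟨a, ha⟩, hC⟩ := exists_monochromatic_properCopy h k fun x => c (g x)
  refine hc _ (hC.1.image hg) ⟨a, ?_⟩
  rintro _ ⟨_, ⟨x, hx, rfl⟩, rfl⟩
  exact ha x hx

lemma lt_metricChromaticNumber (h : SmallRatio ε q) {k n : ℕ} (hkn : 3 ^ k ≤ n) :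
    (k : ℕ∞) < metricChromaticNumber (Fin n → ℝ) (geomProg q) := by
  refine lt_of_lt_of_le (by exact_mod_cast Nat.lt_succ_self k : (k : ℕ∞) < (k + 1 : ℕ)) ?_
  refine le_iInf₂ fun l hl => ?_
  rw [Nat.cast_le, Nat.succ_le_iff]
  by_contra! hlk
  exact not_avoidsWithColours h ((Nat.pow_le_pow_right (by norm_num) hlk).trans hkn) hl

lemma logb_lt_metricChromaticNumber (h : SmallRatio ε q) {n : ℕ} (hn : 1 ≤ n) :
    ENNReal.ofReal (Real.logb 3 n) <
      (metricChromaticNumber (Fin n → ℝ) (geomProg q) : ℝ≥0∞) := by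
  have h1 : ((Nat.log 3 n + 1 : ℕ) : ℕ∞) ≤ metricChromaticNumber (Fin n → ℝ) (geomProg q) := by
    -- The integer part of `log₃ n` colours do not suffice, and one more already exceeds `log₃ n`.
    have := lt_metricChromaticNumber h (Nat.pow_log_le_self 3 (by omega : n ≠ 0))
    simpa using Order.add_one_le_of_lt this
  have h2 : ((Nat.log 3 n + 1 : ℕ) : ℝ≥0∞) ≤
      (metricChromaticNumber (Fin n → ℝ) (geomProg q) : ℝ≥0∞) := by
    simpa using ENat.toENNReal_le.2 h1
  refine lt_of_lt_of_le ?_ h2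
  rw [← ENNReal.ofReal_natCast, ENNReal.ofReal_lt_ofReal_iff (by positivity),
    Real.logb_lt_iff_lt_rpow (by norm_num) (by exact_mod_cast hn), Real.rpow_natCast]
  exact_mod_cast Nat.lt_pow_succ_log_self (by norm_num) n

lemma isLInftyRamsey_geomProg (h : SmallRatio ε q) : IsLInftyRamsey (geomProg q) := by
  refine ENat.tendsto_nhds_top_iff_natCast_lt.2 fun k => ?_
  filter_upwards [eventually_ge_atTop (3 ^ k)] with n hn
  exact lt_metricChromaticNumber h hn

lemma infinite_geomProg (hq : 0 < q) : Infinite (geomProg q) :=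
  (Set.infinite_range_of_injective (geomProg_strictMono hq).injective).to_subtype

lemma exists_smallRatio (hε : 0 < ε) (hε' : ε < 1 / 2) :
    ∃ q₀ : ℝ, 0 < q₀ ∧ ∀ q : ℝ, 0 < q → q ≤ q₀ → SmallRatio ε q := by
  refine ⟨min (ε / 6) (1 / 2 - ε), lt_min (by linarith) (by linarith), fun q hq hle => ?_⟩
  have := le_min_iff.1 hle
  exact ⟨hε, hε', hq, by linarith [this.1], this.2⟩

end copies

theorem theorem7 :
    (∀ ε : ℝ, 0 < ε → ε < 1 / 2 →
      ∃ q₀ : ℝ, 0 < q₀ ∧ ∀ q : ℝ, 0 < q → q ≤ q₀ →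
        ∀ (k : ℕ) (c : epsCube (3 ^ k) ε → Fin k),
          ∃ C : Set (epsCube (3 ^ k) ε),
            IsMonochromatic c C ∧ IsProperCopy q (Subtype.val '' C)) ∧
    (∃ q₀ : ℝ, 0 < q₀ ∧ ∀ q : ℝ, 0 < q → q ≤ q₀ →
      ∀ n : ℕ, 1 ≤ n →
        ENNReal.ofReal (Real.logb 3 n) <
          (metricChromaticNumber (Fin n → ℝ) (geomProg q) : ℝ≥0∞)) ∧
    (∃ (M : Type) (_ : MetricSpace M), Infinite M ∧ IsLInftyRamsey M) := by
  obtain ⟨q₀, hq₀, hsmall⟩ := exists_smallRatio (ε := 1 / 4) (by norm_num) (by norm_num)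
  refine ⟨fun ε hε hε' => ?_, ⟨q₀, hq₀, fun q hq hle n hn => ?_⟩, ?_⟩
  · obtain ⟨q₁, hq₁, hsmall₁⟩ := exists_smallRatio hε hε'
    exact ⟨q₁, hq₁, fun q hq hle => exists_monochromatic_properCopy (hsmall₁ q hq hle)⟩
  · exact logb_lt_metricChromaticNumber (hsmall q hq hle) hn
  · exact ⟨geomProg q₀, inferInstance, infinite_geomProg hq₀,
      isLInftyRamsey_geomProg (hsmall q₀ hq₀ le_rfl)⟩
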